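/- Let $0<\gamma\le 2$, $\alpha=(4-3\gamma)/\sqrt6$, and let $V:\mathbb R\to\mathbb R$ be of class $C^2$ with only finitely many critical points. Put $$W(\phi,y,\rho,H)=H^2-\tfrac13\left(\tfrac12y^2+V(\phi)+\rho\right)$$ and consider the system $$\dot\phi=y,\qquad \dot y=-3Hy-V'(\phi)+\alpha\rho,\qquad \dot\rho=-3\gamma\rho H-\alpha\rho y,\qquad \dot H=-\tfrac12y^2-\tfrac{\gamma}{2}\rho-W$$ for flat and negatively curved Friedmann–Robertson–Walker cosmologies with a fluid coupled to a scalar field (by the Friedmann equation, $W=-k/a^2$, so that $W=0$ for $k=0$ and $W>0$ for $k=-1$). Let $\phi_*$ be a strict local minimum point of $V$, possibly degenerate, with $V(\phi_*)\ge 0$, and let $\mathbf p_*=(\phi_*,0,0,\sqrt{V(\phi_*)/3})$. Then $\mathbf p_*$ is an asymptotically stable equilibrium with respect to initial data in $$S=\{(\phi,y,\rho,H):\ \rho\ge0,\ H\ge0,\ W\ge0\}.$$ That is: $\mathbf p_*\in S$ is an equilibrium; for every neighbourhood $U$ of $\mathbf p_*$ there is a neighbourhood $N$ of $\mathbf p_*$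 such that from every initial datum in $N\cap S$ at $t=0$ there is a solution defined for all $t\ge0$, and every solution with that initial datum on $[0,T)$, $0<T\le\infty$, stays in $U$; and there is a neighbourhood $N$ of $\mathbf p_*$ such that every solution on $[0,\infty)$ with initial datum in $N\cap S$ converges to $\mathbf p_*$ as $t\to+\infty$. -/

import Mathlib

open Filter Topology Set

noncomputable section

/-- `x` is a solution of the autonomous equation `x' = F x` on the time set `I`, starting at `x₀` at
time `0`. At the end point `0` of `I = [0, T)` or `I = [0, ∞)` the derivative is one-sided. -/
def IsSolutionFrom {E : Type*} [NormedAddCommGroup E] [NormedSpace ℝ E]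
    (F : E → E) (x₀ : E) (x : ℝ → E) (I : Set ℝ) : Prop :=
  x 0 = x₀ ∧ IsIntegralCurveOn x (fun _ => F) I

/-- `p` is Lyapunov stable for `x' = F x` with respect to initial data in `S`: for every
neighbourhood `U` of `p`, initial data in `S` sufficiently close to `p` launch a solution that
exists for all times `t ≥ 0`, and every solution launched from them stays in `U`, for as long as
it is defined. -/
def IsLyapunovStableOn {E : Type*} [NormedAddCommGroup E] [NormedSpace ℝ E]
    (F : E → E) (S : Set E) (p : E) : Prop :=
  ∀ U ∈ 𝓝 p, ∃ N ∈ 𝓝 p, ∀ x₀ ∈ N ∩ S,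
    (∃ x : ℝ → E, IsSolutionFrom F x₀ x (Ici 0)) ∧
    (∀ x : ℝ → E, IsSolutionFrom F x₀ x (Ici 0) → ∀ t ∈ Ici (0 : ℝ), x t ∈ U) ∧
    (∀ T > 0, ∀ x : ℝ → E, IsSolutionFrom F x₀ x (Ico 0 T) → ∀ t ∈ Ico 0 T, x t ∈ U)

/-- `p` attracts all solutions with initial data in `S` close to `p`. -/
def IsAttractiveOn {E : Type*} [NormedAddCommGroup E] [NormedSpace ℝ E]
    (F : E → E) (S : Set E) (p : E) : Prop :=
  ∃ N ∈ 𝓝 p, ∀ x₀ ∈ N ∩ S, ∀ x : ℝ → E, IsSolutionFrom F x₀ x (Ici 0) →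
    Tendsto x atTop (𝓝 p)

/-- `p` is an asymptotically stable equilibrium of `x' = F x` with respect to initial data in the
set `S`, which contains `p`. -/
def IsAsymptoticallyStableEquilibriumOn {E : Type*} [NormedAddCommGroup E] [NormedSpace ℝ E]
    (F : E → E) (S : Set E) (p : E) : Prop :=
  p ∈ S ∧ F p = 0 ∧ IsLyapunovStableOn F S p ∧ IsAttractiveOn F S p

namespace FRW

/-- The state `(φ, y, ρ, H)`: scalar field, its time derivative, fluid density, Hubble function. -/
abbrev State : Type := ℝ × ℝ × ℝ × ℝ

/-- The coupling coefficient `α = (4 - 3γ) / √6`. -/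
def coupling (γ : ℝ) : ℝ := (4 - 3 * γ) / √6

/-- `W = H² - (y²/2 + V(φ) + ρ)/3`. By the Friedmann equation `W = -k/a²`. -/
def W (V : ℝ → ℝ) : State → ℝ
  | (φ, y, ρ, H) => H ^ 2 - (1 / 2 * y ^ 2 + V φ + ρ) / 3

/-- The vector field of the coupled system. The last component is the Raychaudhuri equation
`H' = -y²/2 - γρ/2 + k/a²`, with `k/a²` expressed through `-W`. -/
def field (V : ℝ → ℝ) (γ : ℝ) : State → State
  | (φ, y, ρ, H) =>
    (y,
      -3 * H * y - deriv V φ + coupling γ * ρ,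
      -3 * γ * ρ * H - coupling γ * ρ * y,
      -(1 / 2) * y ^ 2 - γ / 2 * ρ - W V (φ, y, ρ, H))

/-- The initial states of cosmologies with nonnegative fluid density that are not contracting, in
the flat or open topologies (`W = 0` for `k = 0`, and `W > 0` for `k = -1`). The boundary `H = 0`
is kept so that the equilibrium belongs to the set also when the minimum of `V` is zero. -/
def flatOrOpenExpanding (V : ℝ → ℝ) : Set State :=
  {s | 0 ≤ s.2.2.1 ∧ 0 ≤ s.2.2.2 ∧ 0 ≤ W V s}

end FRW

end

/-! The Hubble function `H` is itself a strict Lyapunov function on `S`. Writing `V_*` for `V φ_*`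
and `H_* = √(V_* / 3)`, the definition of `W` reads
`y² / 2 + ρ + (V(φ) - V_*) + 3 W = 3 (H² - H_*²)`.
All terms on the left are nonnegative on `S` near `p_*`, so there `H ≥ H_*` with equality only at
`p_*`, while `H' = -y² / 2 - γ ρ / 2 - W ≤ 0`. Moreover `S` is forward invariant near `p_*`, since
each of `ρ`, `W` and `H - H_*` satisfies an inequality `u' ≥ c u`. This gives stability.

For attraction, `H` decreases to a limit, so Barbalat's lemma yields `H' → 0`, whence `y → 0`; a
second application, to `y`, yields `y' → 0`. On `S` near `p_*` both `H'` and `y'` vanish only at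
`p_*`, because `φ_*` is an isolated critical point of `V`, and compactness gives convergence. -/

section Real

theorem nonneg_of_mul_le_deriv {u u' c : ℝ → ℝ} {a b : ℝ}
    (hu : ∀ t ∈ Icc a b, HasDerivWithinAt u (u' t) (Icc a b) t) (hc : ContinuousOn c (Icc a b))
    (ha : 0 ≤ u a) (hle : ∀ t ∈ Icc a b, c t * u t ≤ u' t) : ∀ t ∈ Icc a b, 0 ≤ u t := by
  obtain ⟨M, hM⟩ := isCompact_Icc.bddAbove_image hc
  -- `-u` cannot cross `ε * exp ((M + 1) * (t - a))`, whose logarithmic derivative exceeds `c`.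
  have fence : ∀ ε > 0, ∀ t ∈ Icc a b, -u t ≤ ε * Real.exp ((M + 1) * (t - a)) := by
    intro ε hε
    refine image_le_of_deriv_right_lt_deriv_boundary (f' := fun t => -u' t)
      (B' := fun t => ε * (Real.exp ((M + 1) * (t - a)) * (M + 1)))
      (fun t ht => (hu t ht).continuousWithinAt.neg) (fun t ht => ?_) ?_ (fun t => ?_)
      fun t ht hcross => ?_
    · exact ((hu t (Ico_subset_Icc_self ht)).mono_of_mem_nhdsWithin
        (Icc_mem_nhdsGE_of_mem ht)).neg
    · simpa using by linarith
    · simpa using ((((hasDerivAt_id t).sub_const a).const_mul (M + 1)).exp).const_mul ε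
    · have ht' := Ico_subset_Icc_self ht
      have hpos : 0 < ε * Real.exp ((M + 1) * (t - a)) := by positivity
      have hcM : c t ≤ M := hM (mem_image_of_mem c ht')
      have hu_t : u t = -(ε * Real.exp ((M + 1) * (t - a))) := neg_eq_iff_eq_neg.1 hcross
      have hdrift := hle t ht'
      rw [hu_t] at hdrift
      linarith [mul_le_mul_of_nonneg_right hcM hpos.le]
  intro t ht
  refine neg_nonpos.1 (le_of_forall_pos_le_add fun ε hε => ?_)
  have := fence (ε / Real.exp ((M + 1) * (t - a))) (by positivity) t ht
  rwa [div_mul_cancel₀ _ (Real.exp_ne_zero _), ← zero_add ε] at this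

theorem exists_tendsto_atTop_of_antitoneOn_Ici {f : ℝ → ℝ} {a m : ℝ}
    (hf : AntitoneOn f (Ici a)) (hm : ∀ t ∈ Ici a, m ≤ f t) : ∃ l, Tendsto f atTop (𝓝 l) := by
  have hanti : Antitone fun t => f (max t a) := fun s t hst =>
    hf (le_max_right s a) (le_max_right t a) (max_le_max_right a hst)
  have hbdd : BddBelow (range fun t => f (max t a)) :=
    ⟨m, forall_mem_range.2 fun t => hm _ (le_max_right t a)⟩
  refine ⟨_, (tendsto_atTop_ciInf hanti hbdd).congr' ?_⟩
  filter_upwards [eventually_ge_atTop a] with t ht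
  rw [max_eq_left ht]

/-- **Barbalat's lemma**. -/
theorem tendsto_deriv_zero_of_uniformContinuousOn {E : Type*} [NormedAddCommGroup E]
    [NormedSpace ℝ E] {f f' : ℝ → E} {a : ℝ} {l : E}
    (hf : ∀ t ∈ Ici a, HasDerivWithinAt f (f' t) (Ici a) t)
    (hf' : UniformContinuousOn f' (Ici a)) (hl : Tendsto f atTop (𝓝 l)) :
    Tendsto f' atTop (𝓝 0) := by
  rw [Metric.tendsto_nhds]
  intro ε hε
  obtain ⟨δ, hδ, hδf⟩ := Metric.uniformContinuousOn_iff_le.1 hf' (ε / 2) (half_pos hε)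
  have linearization : ∀ t ∈ Ici a, ‖f (t + δ) - f t - δ • f' t‖ ≤ ε / 2 * δ := by
    intro t ht
    have hsub : Icc t (t + δ) ⊆ Ici a := fun s hs => le_trans ht hs.1
    have hd : ∀ s ∈ Icc t (t + δ), HasDerivWithinAt (fun s => f s - (s - t) • f' t)
        (f' s - f' t) (Icc t (t + δ)) s := fun s hs => by
      exact (((hf s (hsub hs)).mono hsub).sub
        (((hasDerivAt_id s).sub_const t).smul_const (f' t)).hasDerivWithinAt).congr_deriv
        (by rw [one_smul])
    have hbound : ∀ s ∈ Icc t (t + δ), ‖f' s - f' t‖ ≤ ε / 2 := fun s hs => by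
      rw [← dist_eq_norm]
      refine hδf s (hsub hs) t ht ?_
      rw [Real.dist_eq, abs_of_nonneg] <;> linarith [hs.1, hs.2]
    simpa [abs_of_pos hδ, sub_right_comm] using
      (convex_Icc t (t + δ)).norm_image_sub_le_of_norm_hasDerivWithin_le hd hbound
        (left_mem_Icc.2 (by linarith)) (right_mem_Icc.2 (by linarith))
  have hincr : Tendsto (fun t => f (t + δ) - f t) atTop (𝓝 0) := by
    simpa using (hl.comp (tendsto_atTop_add_const_right _ δ tendsto_id)).sub hl
  filter_upwards [eventually_ge_atTop a,
    Metric.tendsto_nhds.1 hincr (ε / 2 * δ) (by positivity)] with t ht hsmall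
  rw [dist_zero_right] at hsmall ⊢
  refine lt_of_mul_lt_mul_left (a := δ) ?_ hδ.le
  calc δ * ‖f' t‖ = ‖δ • f' t‖ := by rw [norm_smul, Real.norm_of_nonneg hδ.le]
    _ ≤ ‖f (t + δ) - f t‖ + ‖f (t + δ) - f t - δ • f' t‖ := by
      simpa using norm_sub_le (f (t + δ) - f t) (f (t + δ) - f t - δ • f' t)
    _ < ε / 2 * δ + ε / 2 * δ := add_lt_add_of_lt_of_le hsmall (linearization t ht)
    _ = δ * ε := by ring

section Prod

variable {E F : Type*} [NormedAddCommGroup E] [NormedSpace ℝ E] [NormedAddCommGroup F]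
  [NormedSpace ℝ F] {x : ℝ → E × F} {x' : E × F} {s : Set ℝ} {t : ℝ}

theorem hasDerivWithinAt_fst (hx : HasDerivWithinAt x x' s t) :
    HasDerivWithinAt (fun t => (x t).1) x'.1 s t :=
  (ContinuousLinearMap.fst ℝ E F).hasFDerivAt.comp_hasDerivWithinAt t hx

theorem hasDerivWithinAt_snd (hx : HasDerivWithinAt x x' s t) :
    HasDerivWithinAt (fun t => (x t).2) x'.2 s t :=
  (ContinuousLinearMap.snd ℝ E F).hasFDerivAt.comp_hasDerivWithinAt t hx

end Prod

end Real

section Topology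

theorem mapsTo_Icc_of_forall_mapsTo_closed_imp_mem_open {ι X : Type*} [TopologicalSpace X]
    [ConditionallyCompleteLinearOrder ι] [TopologicalSpace ι] [OrderTopology ι]
    [DenselyOrdered ι] {U K : Set X} (hU : IsOpen U) (hK : IsClosed K) (hUK : U ⊆ K) {x : ι → X}
    {a b : ι} (hx : ContinuousOn x (Icc a b)) (ha : x a ∈ U)
    (h : ∀ t ∈ Icc a b, MapsTo x (Icc a t) K → x t ∈ U) : MapsTo x (Icc a b) U := by
  have hxK : Icc a b ⊆ x ⁻¹' K := by
    refine IsClosed.Icc_subset_of_forall_mem_nhdsGT_of_Icc_subset ?_ (hUK ha) fun t ht hs => ?_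
    · rw [inter_comm]
      exact hx.preimage_isClosed_of_isClosed isClosed_Icc hK
    · have ht' := Ico_subset_Icc_self ht
      have hxU : ∀ᶠ s in 𝓝[Icc a b] t, x s ∈ U := hx t ht' (hU.mem_nhds (h t ht' hs))
      filter_upwards [nhdsWithin_le_of_mem (Icc_mem_nhdsGT_of_mem ht) hxU] with s hs using hUK hs
  exact fun t ht => h t ht (MapsTo.mono_left hxK (Icc_subset_Icc_right ht.2))

theorem tendsto_of_tendsto_comp_of_isCompact {ι X Y : Type*} [TopologicalSpace X]
    [TopologicalSpace Y] [T2Space Y] {K : Set X} (hK : IsCompact K) {f : X → Y} (hf : Continuous f)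
    {p : X} {q : Y} (hp : ∀ y ∈ K, f y = q → y = p) {l : Filter ι} {x : ι → X}
    (hx : ∀ᶠ i in l, x i ∈ K) (hfx : Tendsto (fun i => f (x i)) l (𝓝 q)) :
    Tendsto x l (𝓝 p) := by
  refine hK.tendsto_nhds_of_unique_mapClusterPt hx fun y hyK hy => hp y hyK ?_
  have hfy : MapClusterPt (f y) l (fun i => f (x i)) := hy.continuousAt_comp hf.continuousAt
  exact eq_of_nhds_neBot (ClusterPt.mono hfy hfx)

end Topology

section IsolatedCriticalPoint

variable {f : ℝ → ℝ} {a : ℝ}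

theorem isLocalMin_of_eventually_nhdsNE_lt (h : ∀ᶠ x in 𝓝[≠] a, f a < f x) : IsLocalMin f a := by
  filter_upwards [eventually_nhdsWithin_iff.1 h] with x hx
  rcases eq_or_ne x a with rfl | hne
  exacts [le_rfl, (hx hne).le]

theorem eventually_nhdsNE_lt_of_isLocalMin (hmin : IsLocalMin f a)
    (hcrit : ∀ᶠ x in 𝓝[≠] a, deriv f x ≠ 0) : ∀ᶠ x in 𝓝[≠] a, f a < f x := by
  filter_upwards [hcrit, hmin.eventually_nhds.filter_mono nhdsWithin_le_nhds] with x hx hfx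
  refine hfx.self_of_nhds.lt_of_ne fun heq => hx (IsLocalMin.deriv_eq_zero ?_)
  filter_upwards [hfx] with y hy
  rwa [← heq]

end IsolatedCriticalPoint

section Flow

variable {E : Type*} [NormedAddCommGroup E] [NormedSpace ℝ E]

theorem IsSolutionFrom.mono {F : E → E} {x₀ : E} {x : ℝ → E} {I J : Set ℝ}
    (hx : IsSolutionFrom F x₀ x I) (hJI : J ⊆ I) : IsSolutionFrom F x₀ x J :=
  ⟨hx.1, hx.2.mono hJI⟩

open scoped Manifold in
theorem exists_isIntegralCurve_of_hasCompactSupport [CompleteSpace E] {F : E → E}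
    (hF : ContDiff ℝ 1 F) (hsupp : HasCompactSupport F) (x₀ : E) :
    ∃ x : ℝ → E, x 0 = x₀ ∧ IsIntegralCurve x (fun _ => F) := by
  obtain ⟨k, hk⟩ := hF.lipschitzWith_of_hasCompactSupport hsupp one_ne_zero
  obtain ⟨M, hM⟩ := hF.continuous.bounded_above_of_compact_support hsupp
  lift M to NNReal using (norm_nonneg _).trans (hM x₀)
  have hpiece (a : ℝ) : ∃ x : ℝ → E, x 0 = x₀ ∧ IsIntegralCurveOn x (fun _ => F) (Ioo (-a) a) := by
    lift |a| to NNReal using abs_nonneg a with b hb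
    have hpicard : IsPicardLindelof (fun _ => F) (tmin := -b) (tmax := b) ⟨0, by simp⟩ x₀
        (M * b) 0 M k :=
      .of_time_independent (fun x _ => hM x) hk.lipschitzOnWith (by simp)
    obtain ⟨x, hx₀, hx⟩ := hpicard.exists_eq_forall_mem_Icc_hasDerivWithinAt₀
    have hsub : Ioo (-a) a ⊆ Icc (-b : ℝ) b := fun t ht => by
      rw [hb]
      exact abs_le.1 ((abs_lt.2 ht).le.trans (le_abs_self a))
    exact ⟨x, hx₀, fun t ht => (hx t (hsub ht)).mono hsub⟩
  have hglue := exists_isMIntegralCurve_iff_exists_isMIntegralCurveOn_Ioo (I := 𝓘(ℝ, E)) (v := F)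
    (contMDiff_vectorSpace_iff_contDiff.2 hF) x₀
  obtain ⟨x, hx₀, hx⟩ := hglue.2 fun a => by
    obtain ⟨x, hx₀, hx⟩ := hpiece a
    exact ⟨x, hx₀, fun t ht => (hx t ht).hasFDerivWithinAt.hasMFDerivWithinAt⟩
  exact ⟨x, hx₀, fun t => (hx t).hasFDerivAt⟩

theorem exists_isSolutionFrom_Ici_of_confined [FiniteDimensional ℝ E] {F : E → E}
    (hF : ContDiff ℝ 1 F) {U K : Set E} (hU : IsOpen U) (hK : IsCompact K) (hUK : U ⊆ K) {x₀ : E}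
    (hx₀ : x₀ ∈ U)
    (hconf : ∀ T ≥ 0, ∀ x, IsSolutionFrom F x₀ x (Icc 0 T) → MapsTo x (Icc 0 T) K → x T ∈ U) :
    ∃ x : ℝ → E, IsSolutionFrom F x₀ x (Ici 0) := by
  obtain ⟨R, hR, hKR⟩ := hK.isBounded.subset_closedBall_lt 0 0
  let b : ContDiffBump (0 : E) := ⟨R, R + 1, hR, lt_add_one R⟩
  have hbF : EqOn (fun y => b y • F y) F K := fun y hy => by
    simp only [b.one_of_mem_closedBall (hKR hy), one_smul]
  obtain ⟨x, hx0, hx⟩ := exists_isIntegralCurve_of_hasCompactSupport (F := fun y => b y • F y)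
    (b.contDiff.smul hF) b.hasCompactSupport.smul_right x₀
  have hsol {I : Set ℝ} (hI : MapsTo x I K) : IsSolutionFrom F x₀ x I :=
    ⟨hx0, fun t ht => (hx t).hasDerivWithinAt.congr_deriv (hbF (hI ht))⟩
  have hstay (T : ℝ) : MapsTo x (Icc 0 T) U :=
    mapsTo_Icc_of_forall_mapsTo_closed_imp_mem_open hU hK.isClosed hUK hx.continuous.continuousOn
      (hx0 ▸ hx₀) fun t ht hxt => hconf t ht.1 x (hsol hxt) hxt
  exact ⟨x, hsol fun t ht => hUK (hstay t ⟨ht, le_rfl⟩)⟩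

theorem antitoneOn_comp_of_fderiv_nonpos {F : E → E} {L : E → ℝ} (hL : Differentiable ℝ L)
    {x : ℝ → E} {I : Set ℝ} (hI : Convex ℝ I) (hx : IsIntegralCurveOn x (fun _ => F) I)
    (hdec : ∀ t ∈ I, fderiv ℝ L (x t) (F (x t)) ≤ 0) : AntitoneOn (L ∘ x) I :=
  antitoneOn_of_hasDerivWithinAt_nonpos hI (hL.continuous.comp_continuousOn hx.continuousOn)
    (fun t ht => ((hL (x t)).hasFDerivAt.comp_hasDerivWithinAt t
      (hx t (interior_subset ht))).mono interior_subset)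
    fun t ht => hdec t (interior_subset ht)

/-- `S` is forward invariant for `x' = F x` as long as the solution remains in `K`. -/
def IsForwardInvariantIn (F : E → E) (S K : Set E) : Prop :=
  ∀ T x, IsIntegralCurveOn x (fun _ => F) (Icc 0 T) → MapsTo x (Icc 0 T) K → x 0 ∈ S →
    MapsTo x (Icc 0 T) S

theorem IsForwardInvariantIn.mono {F : E → E} {S K K' : Set E} (h : IsForwardInvariantIn F S K)
    (hK : K' ⊆ K) : IsForwardInvariantIn F S K' :=
  fun T x hx hxK h₀ => h T x hx (hxK.mono_right hK) h₀

theorem isLyapunovStableOn_of_confined [FiniteDimensional ℝ E] {F : E → E} {S : Set E} {p : E}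
    (hF : ContDiff ℝ 1 F)
    (hconf : ∀ᶠ r in 𝓝[>] (0 : ℝ), ∃ N ∈ 𝓝 p, ∀ x₀ ∈ N ∩ S, ∀ T ≥ 0, ∀ x,
      IsSolutionFrom F x₀ x (Icc 0 T) → MapsTo x (Icc 0 T) (Metric.closedBall p r) →
        x T ∈ Metric.ball p r) :
    IsLyapunovStableOn F S p := by
  intro U hU
  obtain ⟨R, hR, hRU⟩ := Metric.nhds_basis_closedBall.mem_iff.1 hU
  obtain ⟨r, ⟨N, hN, hconf⟩, hr, hrR⟩ := (hconf.and (Ioc_mem_nhdsGT hR)).exists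
  refine ⟨N ∩ Metric.ball p r, inter_mem hN (Metric.ball_mem_nhds p hr), ?_⟩
  rintro x₀ ⟨⟨hx₀N, hx₀r⟩, hx₀S⟩
  have hconf := hconf x₀ ⟨hx₀N, hx₀S⟩
  have hstay {t : ℝ} (ht : 0 ≤ t) {x : ℝ → E} (hx : IsSolutionFrom F x₀ x (Icc 0 t)) : x t ∈ U := by
    have hball : MapsTo x (Icc 0 t) (Metric.ball p r) :=
      mapsTo_Icc_of_forall_mapsTo_closed_imp_mem_open Metric.isOpen_ball Metric.isClosed_closedBall
        Metric.ball_subset_closedBall hx.2.continuousOn (hx.1 ▸ hx₀r)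
        fun s hs => hconf s hs.1 x (hx.mono (Icc_subset_Icc_right hs.2))
    exact hRU (Metric.closedBall_subset_closedBall hrR
      (Metric.ball_subset_closedBall (hball ⟨ht, le_rfl⟩)))
  refine ⟨exists_isSolutionFrom_Ici_of_confined hF Metric.isOpen_ball (isCompact_closedBall p r)
    Metric.ball_subset_closedBall hx₀r hconf, fun x hx t ht => ?_, fun T _ x hx t ht => ?_⟩
  · exact hstay ht (hx.mono Icc_subset_Ici_self)
  · exact hstay ht.1 (hx.mono (Icc_subset_Ico_right ht.2))

theorem isLyapunovStableOn_of_fderiv_nonpos [FiniteDimensional ℝ E] {F : E → E} {S K : Set E}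
    {p : E} {L : E → ℝ} (hF : ContDiff ℝ 1 F) (hS : IsClosed S) (hK : K ∈ 𝓝 p)
    (hinv : IsForwardInvariantIn F S K) (hL : Differentiable ℝ L)
    (hdec : ∀ s ∈ K ∩ S, fderiv ℝ L s (F s) ≤ 0) (hmin : ∀ s ∈ K ∩ S, s ≠ p → L p < L s) :
    IsLyapunovStableOn F S p := by
  obtain ⟨R, hR, hRK⟩ := Metric.nhds_basis_closedBall.mem_iff.1 hK
  refine isLyapunovStableOn_of_confined hF ?_
  filter_upwards [Ioc_mem_nhdsGT hR] with r ⟨hr, hrR⟩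
  have hrK := (Metric.closedBall_subset_closedBall hrR).trans hRK
  obtain ⟨m, hpm, hm⟩ : ∃ m, L p < m ∧ ∀ s ∈ Metric.sphere p r ∩ S, m ≤ L s :=
    ((isCompact_sphere p r).inter_right hS).exists_forall_le' hL.continuous.continuousOn
      fun s hs => hmin s ⟨hrK (Metric.sphere_subset_closedBall hs.1), hs.2⟩
        (Metric.ne_of_mem_sphere hs.1 hr.ne')
  refine ⟨{s | L s < m}, hL.continuous.continuousAt.eventually_lt_const hpm, ?_⟩
  rintro x₀ ⟨hx₀m, hx₀S⟩ T hT x hx hxr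
  have hT' : T ∈ Icc 0 T := right_mem_Icc.2 hT
  have hxS := hinv T x hx.2 (hxr.mono_right hrK) (hx.1 ▸ hx₀S)
  have hLx := antitoneOn_comp_of_fderiv_nonpos hL (convex_Icc 0 T) hx.2 fun t ht =>
    hdec _ ⟨hrK (hxr ht), hxS ht⟩
  have hLT : L (x T) < m := calc
    L (x T) ≤ L (x 0) := hLx (left_mem_Icc.2 hT) hT' hT
    _ = L x₀ := congrArg L hx.1
    _ < m := hx₀m
  exact (hxr hT').lt_of_ne fun hsphere => (hm _ ⟨hsphere, hxS hT'⟩).not_gt hLT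

theorem IsLyapunovStableOn.isAttractiveOn {F : E → E} {S K : Set E} {p : E}
    (hstab : IsLyapunovStableOn F S p) (hK : K ∈ 𝓝 p) (hinv : IsForwardInvariantIn F S K)
    (hconv : ∀ x, IsIntegralCurveOn x (fun _ => F) (Ici 0) → MapsTo x (Ici 0) (K ∩ S) →
      Tendsto x atTop (𝓝 p)) : IsAttractiveOn F S p := by
  obtain ⟨N, hN, hNK⟩ := hstab K hK
  refine ⟨N, hN, fun x₀ hx₀ x hx => hconv x hx.2 fun t ht => ?_⟩
  have hxK : MapsTo x (Ici 0) K := (hNK x₀ hx₀).2.1 x hx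
  have hxS := hinv t x (hx.2.mono Icc_subset_Ici_self) (hxK.mono_left Icc_subset_Ici_self)
    (hx.1 ▸ hx₀.2)
  exact ⟨hxK ht, hxS ⟨ht, le_rfl⟩⟩

theorem tendsto_comp_field_zero_of_tendsto_comp {G : Type*} [NormedAddCommGroup G]
    [NormedSpace ℝ G] {F : E → E} (hF : Continuous F) {K : Set E} (hK : IsCompact K) {x : ℝ → E}
    {a : ℝ} (hx : IsIntegralCurveOn x (fun _ => F) (Ici a)) (hxK : MapsTo x (Ici a) K)
    (ℓ : E →L[ℝ] G) {l : G} (hl : Tendsto (fun t => ℓ (x t)) atTop (𝓝 l)) :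
    Tendsto (fun t => ℓ (F (x t))) atTop (𝓝 0) := by
  obtain ⟨C, hC⟩ := hK.exists_bound_of_continuousOn hF.continuousOn
  have hlip : LipschitzOnWith C.toNNReal x (Ici a) :=
    (convex_Ici a).lipschitzOnWith_of_nnnorm_hasDerivWithin_le hx fun t ht =>
      NNReal.le_toNNReal_of_coe_le (hC _ (hxK ht))
  have hunif : UniformContinuousOn (fun t => ℓ (F (x t))) (Ici a) :=
    (hK.uniformContinuousOn_of_continuous (ℓ.continuous.comp hF).continuousOn).comp
      hlip.uniformContinuousOn hxK
  exact tendsto_deriv_zero_of_uniformContinuousOn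
    (fun t ht => ℓ.hasFDerivAt.comp_hasDerivWithinAt t (hx t ht)) hunif hl

end Flow

namespace FRW

variable {V : ℝ → ℝ} {γ φs : ℝ}

/-- The rest point at the minimum point `φs` of the potential, with Hubble function determined by
the Friedmann constraint `W = 0`. -/
noncomputable def equilibrium (V : ℝ → ℝ) (φs : ℝ) : State := (φs, 0, 0, √(V φs / 3))

/-- The coordinate `y` of a state, as a linear observable. -/
def velocity : State →L[ℝ] ℝ := .fst ℝ ℝ (ℝ × ℝ) ∘L .snd ℝ ℝ (ℝ × ℝ × ℝ)

/-- The coordinate `H` of a state, as a linear observable. It is the Lyapunov function of the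
equilibrium. -/
def hubble : State →L[ℝ] ℝ := .snd ℝ ℝ ℝ ∘L .snd ℝ ℝ (ℝ × ℝ) ∘L .snd ℝ ℝ (ℝ × ℝ × ℝ)

/-- The states whose scalar field is `φs` or has a potential larger than `V φs`: a neighbourhood of
the equilibrium when `φs` is a strict local minimum point of `V`. -/
def potentialWell (V : ℝ → ℝ) (φs : ℝ) : Set State := {s | s.1 ≠ φs → V φs < V s.1}

@[simp]
theorem velocity_apply (s : State) : velocity s = s.2.1 := rfl

@[simp]
theorem hubble_apply (s : State) : hubble s = s.2.2.2 := rfl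

theorem hubble_field (s : State) :
    hubble (field V γ s) = -(1 / 2) * s.2.1 ^ 2 - γ / 2 * s.2.2.1 - W V s := rfl

theorem contDiff_field (hV : ContDiff ℝ 2 V) : ContDiff ℝ 1 (field V γ) := by
  have hV₁ : ContDiff ℝ 1 V := hV.of_le one_le_two
  have hV' : ContDiff ℝ 1 (deriv V) := (contDiff_succ_iff_deriv (n := 1).1 hV).2.2
  unfold field W
  fun_prop

theorem continuous_W (hV : Continuous V) : Continuous (W V) := by
  unfold W
  fun_prop

theorem isClosed_flatOrOpenExpanding (hV : Continuous V) :
    IsClosed (flatOrOpenExpanding V) := by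
  have hW : IsClosed {s | 0 ≤ W V s} := isClosed_le continuous_const (continuous_W hV)
  have hρ : IsClosed {s : State | 0 ≤ s.2.2.1} := isClosed_le continuous_const (by fun_prop)
  have hH : IsClosed {s : State | 0 ≤ s.2.2.2} := isClosed_le continuous_const (by fun_prop)
  exact hρ.inter (hH.inter hW)

theorem hasDerivWithinAt_W {x : ℝ → State} {I : Set ℝ} {t : ℝ} (hV : Differentiable ℝ V)
    (hx : HasDerivWithinAt x (field V γ (x t)) I t) :
    HasDerivWithinAt (fun s => W V (x s)) (-(2 * (x t).2.2.2) * W V (x t)) I t := by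
  have hφ := hasDerivWithinAt_fst hx
  have hyρH := hasDerivWithinAt_snd hx
  have hy := hasDerivWithinAt_fst hyρH
  have hρ := hasDerivWithinAt_fst (hasDerivWithinAt_snd hyρH)
  have hH := hasDerivWithinAt_snd (hasDerivWithinAt_snd hyρH)
  have hVφ := (hV (x t).1).hasDerivAt.comp_hasDerivWithinAt t hφ
  have hsum := (((hy.pow 2).const_mul (1 / 2)).add hVφ).add hρ
  refine ((hH.pow 2).sub (hsum.div_const 3)).congr_deriv ?_
  simp only [field, W]
  ring

theorem equilibrium_mem_flatOrOpenExpanding (hnonneg : 0 ≤ V φs) :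
    equilibrium V φs ∈ flatOrOpenExpanding V := by
  refine ⟨le_rfl, Real.sqrt_nonneg _, le_of_eq ?_⟩
  simp only [equilibrium, W, Real.sq_sqrt (div_nonneg hnonneg zero_le_three)]
  ring

theorem field_equilibrium (hderiv : deriv V φs = 0) (hnonneg : 0 ≤ V φs) :
    field V γ (equilibrium V φs) = 0 := by
  simp only [equilibrium, field, W, hderiv, Real.sq_sqrt (div_nonneg hnonneg zero_le_three)]
  ext <;> simp

theorem energy_balance (hnonneg : 0 ≤ V φs) (s : State) :
    1 / 2 * s.2.1 ^ 2 + s.2.2.1 + (V s.1 - V φs) + 3 * W V s =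
      3 * (hubble s + √(V φs / 3)) * (hubble s - √(V φs / 3)) := by
  have hsq := Real.sq_sqrt (div_nonneg hnonneg zero_le_three)
  simp only [W, hubble_apply]
  linear_combination 3 * hsq

theorem sqrt_le_hubble {s : State} (hs : s ∈ flatOrOpenExpanding V) (hmin : V φs ≤ V s.1) :
    √(V φs / 3) ≤ hubble s := by
  obtain ⟨hρ, hH, hW⟩ := hs
  refine Real.sqrt_le_iff.2 ⟨hH, ?_⟩
  simp only [W, hubble_apply] at hW ⊢
  linarith [sq_nonneg s.2.1]

theorem sq_velocity_le_hubble_field (hγ : 0 < γ) {s : State} (hs : s ∈ flatOrOpenExpanding V) :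
    velocity s ^ 2 ≤ -2 * hubble (field V γ s) := by
  obtain ⟨hρ, -, hW⟩ := hs
  rw [hubble_field, velocity_apply]
  linarith [mul_nonneg hγ.le hρ]

theorem hubble_field_nonpos (hγ : 0 < γ) {s : State} (hs : s ∈ flatOrOpenExpanding V) :
    hubble (field V γ s) ≤ 0 := by
  linarith [sq_velocity_le_hubble_field hγ hs, sq_nonneg (velocity s)]

theorem neg_mul_hubble_sub_sqrt_le_hubble_field (hγ : 0 < γ) (hnonneg : 0 ≤ V φs) {s : State}
    (hρ : 0 ≤ s.2.2.1) (hW : 0 ≤ W V s) (hmin : V φs ≤ V s.1) :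
    -(3 * (1 + γ) * (hubble s + √(V φs / 3))) * (hubble s - √(V φs / 3)) ≤
      hubble (field V γ s) := by
  have hV : 0 ≤ V s.1 - V φs := sub_nonneg.2 hmin
  calc -(3 * (1 + γ) * (hubble s + √(V φs / 3))) * (hubble s - √(V φs / 3))
      = -((1 + γ) * (1 / 2 * s.2.1 ^ 2 + s.2.2.1 + (V s.1 - V φs) + 3 * W V s)) := by
        rw [energy_balance hnonneg]
        ring
    _ ≤ hubble (field V γ s) := by
        rw [hubble_field]
        have hrest : 0 ≤ γ / 2 * s.2.1 ^ 2 + (1 + γ / 2) * s.2.2.1 + (1 + γ) * (V s.1 - V φs) +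
            (2 + 3 * γ) * W V s := by positivity
        linarith

theorem isForwardInvariantIn_flatOrOpenExpanding (hV : Differentiable ℝ V) (hγ : 0 < γ)
    (hnonneg : 0 ≤ V φs) :
    IsForwardInvariantIn (field V γ) (flatOrOpenExpanding V) {s | V φs ≤ V s.1} := by
  intro T x hx hmin h₀
  have hcont := hx.continuousOn
  have hρ : ∀ t ∈ Icc 0 T, 0 ≤ (x t).2.2.1 :=
    nonneg_of_mul_le_deriv (c := fun t => -(3 * γ * (x t).2.2.2 + coupling γ * (x t).2.1))
      (fun t ht => hasDerivWithinAt_fst (hasDerivWithinAt_snd (hasDerivWithinAt_snd (hx t ht))))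
      (by fun_prop) h₀.1 fun t _ => by simp only [field]; linarith
  have hW : ∀ t ∈ Icc 0 T, 0 ≤ W V (x t) :=
    nonneg_of_mul_le_deriv (fun t ht => hasDerivWithinAt_W hV (hx t ht)) (by fun_prop) h₀.2.2
      fun t _ => le_rfl
  intro t ht
  have hH : 0 ≤ hubble (x t) - √(V φs / 3) :=
    nonneg_of_mul_le_deriv (u := fun t => hubble (x t) - √(V φs / 3))
      (fun t ht => (hubble.hasFDerivAt.comp_hasDerivWithinAt t (hx t ht)).sub_const _)
      (c := fun t => -(3 * (1 + γ) * (hubble (x t) + √(V φs / 3)))) (by fun_prop)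
      (sub_nonneg.2 (sqrt_le_hubble h₀ (hmin ⟨le_rfl, ht.1.trans ht.2⟩)))
      (fun t ht => neg_mul_hubble_sub_sqrt_le_hubble_field hγ hnonneg (hρ t ht) (hW t ht)
        (hmin ht)) t ht
  exact ⟨hρ t ht, (Real.sqrt_nonneg _).trans (sub_nonneg.1 hH), hW t ht⟩

theorem potentialWell_subset : potentialWell V φs ⊆ {s | V φs ≤ V s.1} := fun s hs => by
  rcases eq_or_ne s.1 φs with heq | hne
  exacts [(congrArg V heq).ge, (hs hne).le]

theorem sqrt_lt_hubble (hnonneg : 0 ≤ V φs) {s : State} (hs : s ∈ flatOrOpenExpanding V)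
    (hmin : s ∈ potentialWell V φs) (hne : s ≠ equilibrium V φs) : √(V φs / 3) < hubble s := by
  have hmin' : V φs ≤ V s.1 := potentialWell_subset hmin
  refine (sqrt_le_hubble hs hmin').lt_of_ne fun hH => hne ?_
  obtain ⟨hρ_nonneg, -, hW_nonneg⟩ := hs
  have hbal := energy_balance hnonneg s
  rw [← hH, sub_self, mul_zero] at hbal
  have hy : s.2.1 ^ 2 = 0 := by linarith [sq_nonneg s.2.1]
  have hρ : s.2.2.1 = 0 := by linarith [sq_nonneg s.2.1]
  have hφ : s.1 = φs := by
    by_contra hφ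
    linarith [hmin hφ, sq_nonneg s.2.1]
  exact Prod.ext hφ (Prod.ext (pow_eq_zero_iff two_ne_zero |>.1 hy) (Prod.ext hρ hH.symm))

theorem eventually_nhds_equilibrium {P : ℝ → Prop} (hP : ∀ᶠ φ in 𝓝[≠] φs, P φ) :
    ∀ᶠ s in 𝓝 (equilibrium V φs), s.1 ≠ φs → P s.1 :=
  (continuousAt_fst (p := equilibrium V φs)).eventually (eventually_nhdsWithin_iff.1 hP)

theorem isLyapunovStableOn_equilibrium (hV : ContDiff ℝ 2 V) (hγ : 0 < γ)
    (hmin : ∀ᶠ φ in 𝓝[≠] φs, V φs < V φ) (hnonneg : 0 ≤ V φs) :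
    IsLyapunovStableOn (field V γ) (flatOrOpenExpanding V) (equilibrium V φs) := by
  have hinv := (isForwardInvariantIn_flatOrOpenExpanding
    (hV.differentiable two_ne_zero) hγ hnonneg).mono potentialWell_subset
  refine isLyapunovStableOn_of_fderiv_nonpos (contDiff_field hV)
    (isClosed_flatOrOpenExpanding hV.continuous) (eventually_nhds_equilibrium hmin) hinv
    hubble.differentiable (fun s hs => ?_) fun s hs => sqrt_lt_hubble hnonneg hs.2 hs.1
  rw [hubble.fderiv]
  exact hubble_field_nonpos hγ hs.2

theorem eq_equilibrium_of_field_eq_zero (hγ : 0 < γ) {s : State} (hs : s ∈ flatOrOpenExpanding V)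
    (hcrit : s.1 ≠ φs → deriv V s.1 ≠ 0) (hy' : velocity (field V γ s) = 0)
    (hH' : hubble (field V γ s) = 0) : s = equilibrium V φs := by
  obtain ⟨hρ_nonneg, hH_nonneg, hW_nonneg⟩ := hs
  have hγρ := mul_nonneg hγ.le hρ_nonneg
  rw [hubble_field] at hH'
  have hy : s.2.1 = 0 := pow_eq_zero_iff two_ne_zero |>.1 (by linarith [sq_nonneg s.2.1])
  have hρ : s.2.2.1 = 0 := by
    have : γ * s.2.2.1 = 0 := by linarith [sq_nonneg s.2.1]
    exact (mul_eq_zero.1 this).resolve_left hγ.ne'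
  have hW : W V s = 0 := by linarith [sq_nonneg s.2.1]
  have hφ : s.1 = φs := by
    by_contra hφ
    simp only [velocity_apply, field, hy, hρ] at hy'
    exact hcrit hφ (by linarith)
  have hH : s.2.2.2 = √(V φs / 3) := by
    simp only [W, hy, hρ, hφ] at hW
    rw [← Real.sqrt_sq hH_nonneg]
    congr 1
    linarith
  exact Prod.ext hφ (Prod.ext hy (Prod.ext hρ hH))

theorem tendsto_equilibrium_of_mapsTo (hV : ContDiff ℝ 2 V) (hγ : 0 < γ) {K : Set State}
    (hK : IsCompact K) (hcrit : ∀ s ∈ K, s.1 ≠ φs → deriv V s.1 ≠ 0) {x : ℝ → State}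
    (hx : IsIntegralCurveOn x (fun _ => field V γ) (Ici 0))
    (hxK : MapsTo x (Ici 0) (K ∩ flatOrOpenExpanding V)) :
    Tendsto x atTop (𝓝 (equilibrium V φs)) := by
  have hfield : Continuous (field V γ) := (contDiff_field hV).continuous
  have hxK' : MapsTo x (Ici 0) K := hxK.mono_right inter_subset_left
  have hdec : AntitoneOn (hubble ∘ x) (Ici 0) :=
    antitoneOn_comp_of_fderiv_nonpos hubble.differentiable (convex_Ici 0) hx fun t ht => by
      rw [hubble.fderiv]
      exact hubble_field_nonpos hγ (hxK ht).2
  obtain ⟨H₀, hH⟩ := exists_tendsto_atTop_of_antitoneOn_Ici hdec fun t ht => (hxK ht).2.2.1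
  have hH' := tendsto_comp_field_zero_of_tendsto_comp hfield hK hx hxK' hubble hH
  have hy : Tendsto (fun t => velocity (x t)) atTop (𝓝 0) := by
    have hbound := (hH'.const_mul (-2)).sqrt
    rw [mul_zero, Real.sqrt_zero] at hbound
    refine squeeze_zero_norm' ?_ hbound
    filter_upwards [eventually_ge_atTop 0] with t ht
    exact Real.abs_le_sqrt (sq_velocity_le_hubble_field hγ (hxK ht).2)
  have hy' := tendsto_comp_field_zero_of_tendsto_comp hfield hK hx hxK' velocity hy
  refine tendsto_of_tendsto_comp_of_isCompact
    (hK.inter_right (isClosed_flatOrOpenExpanding hV.continuous))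
    (f := fun s => (velocity (field V γ s), hubble (field V γ s))) (by fun_prop)
    (fun s hs hzero => eq_equilibrium_of_field_eq_zero hγ hs.2 (hcrit s hs.1)
      (congrArg Prod.fst hzero) (congrArg Prod.snd hzero))
    ((eventually_ge_atTop 0).mono hxK) (hy'.prodMk_nhds hH')

theorem isAttractiveOn_equilibrium (hV : ContDiff ℝ 2 V) (hγ : 0 < γ)
    (hmin : ∀ᶠ φ in 𝓝[≠] φs, V φs < V φ) (hcrit : ∀ᶠ φ in 𝓝[≠] φs, deriv V φ ≠ 0)
    (hnonneg : 0 ≤ V φs) :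
    IsAttractiveOn (field V γ) (flatOrOpenExpanding V) (equilibrium V φs) := by
  obtain ⟨K, hK_mem, hK_sub, hK⟩ := local_compact_nhds
    (eventually_nhds_equilibrium (V := V) (hmin.and hcrit))
  have hK_well : K ⊆ potentialWell V φs := fun s hs hne => (hK_sub hs hne).1
  have hinv := (isForwardInvariantIn_flatOrOpenExpanding
    (hV.differentiable two_ne_zero) hγ hnonneg).mono (hK_well.trans potentialWell_subset)
  have hstab := isLyapunovStableOn_equilibrium hV hγ hmin hnonneg
  exact hstab.isAttractiveOn hK_mem hinv fun x hx hxK =>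
    tendsto_equilibrium_of_mapsTo hV hγ hK (fun s hs hne => (hK_sub hs hne).2) hx hxK

end FRW

theorem proposition1_general (V : ℝ → ℝ) (hV : ContDiff ℝ 2 V) (γ : ℝ) (hγ : 0 < γ) (φs : ℝ)
    (hmin : IsLocalMin V φs) (hcrit : ∀ᶠ φ in 𝓝[≠] φs, deriv V φ ≠ 0) (hnonneg : 0 ≤ V φs) :
    IsAsymptoticallyStableEquilibriumOn (FRW.field V γ) (FRW.flatOrOpenExpanding V)
      (φs, 0, 0, √(V φs / 3)) := by
  have hstrict := eventually_nhdsNE_lt_of_isLocalMin hmin hcrit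
  exact ⟨FRW.equilibrium_mem_flatOrOpenExpanding hnonneg,
    FRW.field_equilibrium hmin.deriv_eq_zero hnonneg,
    FRW.isLyapunovStableOn_equilibrium hV hγ hstrict hnonneg,
    FRW.isAttractiveOn_equilibrium hV hγ hstrict hcrit hnonneg⟩

theorem proposition1 (V : ℝ → ℝ) (hV : ContDiff ℝ 2 V)
    (hcrit : {φ : ℝ | deriv V φ = 0}.Finite)
    (γ : ℝ) (hγ : 0 < γ) (hγ' : γ ≤ 2)
    (φs : ℝ) (hmin : ∀ᶠ φ in 𝓝[≠] φs, V φs < V φ) (hnonneg : 0 ≤ V φs) :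
    IsAsymptoticallyStableEquilibriumOn (FRW.field V γ) (FRW.flatOrOpenExpanding V)
      (φs, 0, 0, √(V φs / 3)) :=
  proposition1_general V hV γ hγ φs (isLocalMin_of_eventually_nhdsNE_lt hmin)
    (hcrit.eventually_cofinite_notMem.filter_mono (nhdsNE_le_cofinite φs)) hnonneg
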